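/- **Setting.** Let $K$ be a field of characteristic zero and let $\mathcal F$ be the field of formal series $a=\sum_i a_it^{\alpha_i}$ with $a_i\in K$ and strictly increasing real exponents without limit points. Let $\|a\|$ be the least exponent of $a$ ($\|0\|=\infty$) and $R=\{a\in\mathcal F:\|a\|\ge 0\}$. An $\mathbb R$-partition of length $r$ is a sequence $\mu_1\ge\dots\ge\mu_r$ of reals; put $D_\mu=\mathrm{diag}(t^{\mu_1},\dots,t^{\mu_r})$ and $\widehat\nu=(\nu_r,\dots,\nu_1)$. For $k$-element index sets $I=(i_1<\dots<i_k)$, $H=(h_1<\dots<h_k)$ in $\{1,\dots,r\}$ write $I\subseteq H$ if $i_s\le h_s$ for all $s$, $|\mu_I|=\sum_s\mu_{i_s}$, and let $\|A_{IJ}\|$ be the order of the minor of $A$ with rows $I$ and columns $J$. **Generic matrices.** $Q\in GL_r(R)$ is $\mu$-admissible if $D_\mu QD_\mu^{-1}\in GL_r(R)$, and $T\in GL_r(R)$ is $\widehat\nu$-admissible if $D_{\widehat\nu}^{-1}TD_{\widehat\nu}\in GL_r(R)$. A lower triangular $L\in GL_r(R)$ is *$\mu$-$\widehat\nu$-generic*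 if it factors over $GL_r(R)$ as $L=Q_LQ_US\,T_UT_L$ (subscripts: lower, upper triangular) with $Q_LQ_U$ $\mu$-admissible and $T_UT_L$ $\widehat\nu$-admissible, and for all index sets $I,H,J$ of equal length: * $\|L_{IJ}\|\le\|L_{HJ}\|$ if $J\subseteq I\subseteq H$, and $\|L_{HJ}\|\le\|L_{IJ}\|+|\mu_I|-|\mu_H|$ if $I\subseteq H$; * $\|L_{IJ}\|\le\|L_{IH}\|$ if $H\subseteq J\subseteq I$, and $\|L_{IH}\|\le\|L_{IJ}\|+|\widehat\nu_J|-|\widehat\nu_H|$ if $H\subseteq J$. An upper triangular matrix $N^*$ is *$\mu$-generic* if $N^*=QNT^{-1}$ with $N$ invertible over $\mathcal F$, $T\in GL_r(R)$, and $Q$ $\mu$-admissible and factoring over $GL_r(R)$ both as upper times lower and as lower times upper triangular, such that for all index sets $\|(QN)_{IJ}\|\le\|(QN)_{HJ}\|\le\|(QN)_{IJ}\|+|\mu_I|-|\mu_H|$ if $I\subseteq H$, and $\|N^*_{IJ}\|\le\|N^*_{IH}\|$ if $H\subseteq J$. **Fillings.** The orbit of a pair $(M,N)$ of matrices over $\mathcal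 F$ consists of the pairs $(PMQ^{-1},QNT^{-1})$ with $P,Q,T\in GL_r(R)$. A *right filling* of $(M,N)$ is a family $\{k_{ij}\}_{1\le i\le j\le r}$ such that, for some $\mathbb R$-partition $\mu$ and some $\mu$-generic $N^*$ with $(D_\mu,N^*)$ in the orbit of $(M,N)$, $$k_{1j}+\dots+k_{ij}=\big\|\big((j-i)^\wedge,\dots,(j-1)^\wedge\big)\big\|-\big\|\big((j-i+1)^\wedge,\dots,j^\wedge\big)\big\|\qquad(1\le i\le j\le r),$$ where $\|(p^\wedge,\dots,q^\wedge)\|$ is the order of the minor of $N^*$ using all rows except $p,\dots,q$ and the right-most columns (for $p=0$ only rows $1,\dots,q$ are omitted; nothing is omitted if $p>q$). The left filling of $(M,N)$ is the right filling of $(N^{T},M^{T})$. **Statement.** Let $\mu,\nu$ be $\mathbb R$-partitions of length $r$ and let $L$ be $\mu$-$\widehat\nu$-generic. 1. Suppose $\nu_i\ge0$ for all $i$. Let $0\le\sigma<r$, $0<\alpha\le\nu_{\sigma+1}$ and $\nu^*=(\nu_1,\dots,\nu_\sigma,\alpha,0,\dots,0)$. If $\{k_{ij}\}$ and $\{k^*_{ij}\}$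 are right fillings of $(D_\mu,LD_{\widehat\nu})$ and $(D_\mu,LD_{\widehat{\nu^*}})$, then $k_{ij}=k^*_{ij}$ for $1\le i\le\sigma$, $i\le j\le r$. 2. Suppose $\mu_i\ge0$ for all $i$. Let $0\le\sigma<r$, $0<\alpha\le\mu_{\sigma+1}$ and $\mu^*=(\mu_1,\dots,\mu_\sigma,\alpha,0,\dots,0)$. If $\{m_{ij}\}$ and $\{m^*_{ij}\}$ are left fillings of $(D_\mu,LD_{\widehat\nu})$ and $(D_{\mu^*},LD_{\widehat\nu})$, then $m_{ij}=m^*_{ij}$ for $1\le i\le\sigma$, $i\le j\le r$. -/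

import Mathlib

/-! ### The field of real-exponent Laurent series with sparse exponents -/

/-- A Hahn series with real exponents is sparse if only finitely many of its exponents lie below any
given bound; equivalently its exponents are bounded below and have no limit point, so that it is
`∑ aᵢ t ^ αᵢ` with a finite, or an infinite unbounded, strictly increasing sequence `αᵢ`. -/
def IsSparse {K : Type*} [Field K] (a : HahnSeries ℝ K) : Prop :=
  ∀ b : ℝ, (a.support ∩ Set.Iic b).Finite

theorem IsSparse.single {K : Type*} [Field K] (s : ℝ) (c : K) :
    IsSparse (HahnSeries.single s c) := fun _ =>
  (Set.finite_singleton s).subset fun _ hx => HahnSeries.support_single_subset hx.1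

theorem IsSparse.neg {K : Type*} [Field K] {a : HahnSeries ℝ K} (ha : IsSparse a) :
    IsSparse (-a) := fun b => by
  rw [HahnSeries.support_neg]; exact ha b

theorem IsSparse.add {K : Type*} [Field K] {a b : HahnSeries ℝ K} (ha : IsSparse a)
    (hb : IsSparse b) : IsSparse (a + b) := fun c => by
  refine ((ha c).union (hb c)).subset ?_
  rintro x ⟨hx, hxc⟩
  rcases HahnSeries.support_add_subset a b hx with h | h
  · exact Or.inl ⟨h, hxc⟩
  · exact Or.inr ⟨h, hxc⟩

theorem HahnSeries.order_le_of_mem_support {K : Type*} [Field K] {a : HahnSeries ℝ K} {x : ℝ}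
    (hx : x ∈ a.support) : a.order ≤ x :=
  HahnSeries.order_le_of_coeff_ne_zero hx

theorem IsSparse.mul {K : Type*} [Field K] {a b : HahnSeries ℝ K} (ha : IsSparse a)
    (hb : IsSparse b) : IsSparse (a * b) := fun c => by
  refine ((ha (c - b.order)).image2 (· + ·) (hb (c - a.order))).subset ?_
  rintro x ⟨hx, hxc⟩
  obtain ⟨u, hu, v, hv, rfl⟩ := HahnSeries.support_mul_subset hx
  have h1 := HahnSeries.order_le_of_mem_support hu
  have h2 := HahnSeries.order_le_of_mem_support hv
  simp only [Set.mem_Iic] at hxc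
  exact ⟨u, ⟨hu, by simp only [Set.mem_Iic]; linarith⟩,
    v, ⟨hv, by simp only [Set.mem_Iic]; linarith⟩, rfl⟩

theorem IsSparse.of_eq_single_add_mul {K : Type*} [Field K] {y z : HahnSeries ℝ K} {s ε : ℝ}
    {c : K} (hz : IsSparse z) (hε : 0 < ε) (hzε : ∀ u ∈ z.support, ε ≤ u)
    (h : y = HahnSeries.single s c + z * y) : IsSparse y := by
  have key : ∀ n : ℕ, (y.support ∩ Set.Iic (y.order + n * ε)).Finite := by
    intro n
    induction n with
    | zero =>
      refine (Set.finite_singleton y.order).subset ?_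
      rintro x ⟨hx, hxb⟩
      have := HahnSeries.order_le_of_mem_support hx
      simp only [Set.mem_Iic, Nat.cast_zero, zero_mul, add_zero] at hxb
      exact le_antisymm hxb this
    | succ n ih =>
      refine ((Set.finite_singleton s).union
        ((hz ((n + 1 : ℕ) * ε)).image2 (· + ·) ih)).subset ?_
      rintro x ⟨hx, hxb⟩
      rw [h] at hx
      rcases HahnSeries.support_add_subset _ _ hx with h1 | h1
      · exact Or.inl (HahnSeries.support_single_subset h1)
      · obtain ⟨u, hu, v, hv, rfl⟩ := HahnSeries.support_mul_subset h1
        have h2 := HahnSeries.order_le_of_mem_support hv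
        have h3 := hzε u hu
        simp only [Set.mem_Iic] at hxb
        push_cast at hxb
        refine Or.inr ⟨u, ⟨hu, ?_⟩, v, ⟨hv, ?_⟩, rfl⟩
        · simp only [Set.mem_Iic]; push_cast; linarith
        · simp only [Set.mem_Iic]; linarith
  intro b
  obtain ⟨n, hn⟩ := exists_nat_ge ((b - y.order) / ε)
  refine (key n).subset (Set.inter_subset_inter_right _ (Set.Iic_subset_Iic.2 ?_))
  rw [div_le_iff₀ hε] at hn
  linarith

theorem IsSparse.inv {K : Type*} [Field K] {a : HahnSeries ℝ K} (ha : IsSparse a) :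
    IsSparse a⁻¹ := by
  by_cases h0 : a = 0
  · subst h0; rw [inv_zero]; exact ha
  set α := a.order with hα
  set c := a.leadingCoeff with hc
  have hc0 : c ≠ 0 := HahnSeries.leadingCoeff_ne_zero.2 h0
  set x : HahnSeries ℝ K := a - HahnSeries.single α c with hx
  have hxs : IsSparse x := by
    rw [hx, sub_eq_add_neg]; exact ha.add (IsSparse.single α c).neg
  have hxα : ∀ u ∈ x.support, α < u := by
    intro u hu
    rw [HahnSeries.mem_support, hx, HahnSeries.coeff_sub] at hu
    by_cases hua : u = α
    · subst hua
      rw [HahnSeries.coeff_single_same, hc, HahnSeries.leadingCoeff_eq] at hu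
      exact absurd (sub_self _) hu
    · rw [HahnSeries.coeff_single_of_ne hua, sub_zero] at hu
      exact lt_of_le_of_ne (HahnSeries.order_le_of_mem_support hu) (Ne.symm hua)
  set z : HahnSeries ℝ K := -(HahnSeries.single (-α) c⁻¹ * x) with hz
  have hzs : IsSparse z := ((IsSparse.single _ _).mul hxs).neg
  have hz0 : ∀ u ∈ z.support, 0 < u := by
    intro u hu
    rw [hz, HahnSeries.support_neg] at hu
    obtain ⟨p, hp, q, hq, rfl⟩ := HahnSeries.support_mul_subset hu
    have h1 := HahnSeries.support_single_subset hp
    simp only [Set.mem_singleton_iff] at h1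
    have h2 := hxα q hq
    simp only
    linarith
  have hy : a⁻¹ = HahnSeries.single (-α) c⁻¹ + z * a⁻¹ := by
    have h1 : HahnSeries.single (-α) c⁻¹ * HahnSeries.single α c = (1 : HahnSeries ℝ K) := by
      rw [HahnSeries.single_mul_single, neg_add_cancel, inv_mul_cancel₀ hc0]; rfl
    have h2 : a * a⁻¹ = 1 := mul_inv_cancel₀ h0
    rw [hz, hx]
    linear_combination (HahnSeries.single (-α) c⁻¹) * h2 - a⁻¹ * h1
  by_cases hzz : z = 0
  · exact hzs.of_eq_single_add_mul one_pos (by rw [hzz]; simp) hy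
  · refine hzs.of_eq_single_add_mul (hz0 z.order ?_)
      (fun u hu => HahnSeries.order_le_of_mem_support hu) hy
    rw [HahnSeries.mem_support, ← HahnSeries.leadingCoeff_eq]
    exact HahnSeries.leadingCoeff_ne_zero.2 hzz

/-- The field `F` of formal series `∑ aᵢ t ^ αᵢ` with coefficients in `K` and sparse real
exponents. -/
def sparseSeries (K : Type*) [Field K] : Subfield (HahnSeries ℝ K) where
  carrier := {a | IsSparse a}
  mul_mem' := IsSparse.mul
  one_mem' := IsSparse.single 0 1
  add_mem' := IsSparse.add
  zero_mem' := fun b => by simp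
  neg_mem' := IsSparse.neg
  inv_mem' := fun _ => IsSparse.inv

/-- The order `‖a‖` of `a ∈ F`: its least exponent, with `‖0‖ = ⊤`. -/
noncomputable def sOrd {K : Type*} [Field K] (a : sparseSeries K) : WithTop ℝ :=
  HahnSeries.orderTop (a : HahnSeries ℝ K)

/-- The element `t ^ s` of `F`. -/
noncomputable def tPow (K : Type*) [Field K] (s : ℝ) : sparseSeries K :=
  ⟨HahnSeries.single s 1, IsSparse.single s 1⟩

/-- The valuation ring `R = {a ∈ F : ‖a‖ ≥ 0}`. -/
noncomputable def valRing (K : Type*) [Field K] : Subring (sparseSeries K) where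
  carrier := {a | 0 ≤ sOrd a}
  mul_mem' := fun {a b} ha hb =>
    (add_nonneg ha hb).trans
      (HahnSeries.orderTop_add_le_mul (x := (a : HahnSeries ℝ K)) (y := (b : HahnSeries ℝ K)))
  one_mem' := (HahnSeries.orderTop_one (Γ := ℝ) (R := K)).ge
  add_mem' := fun {a b} ha hb =>
    (le_min ha hb).trans
      (HahnSeries.min_orderTop_le_orderTop_add (x := (a : HahnSeries ℝ K))
        (y := (b : HahnSeries ℝ K)))
  zero_mem' := by simp [sOrd]
  neg_mem' := fun {a} ha =>
    le_of_le_of_eq ha (HahnSeries.orderTop_neg (x := (a : HahnSeries ℝ K))).symm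

/-- `r × r` matrices over `F`. -/
abbrev FMat (K : Type*) [Field K] (r : ℕ) : Type _ := Matrix (Fin r) (Fin r) (sparseSeries K)

/-- The matrix over `F` lies in `GL_r(R)`. -/
def InGLR {K : Type*} [Field K] {r : ℕ} (A : FMat K r) : Prop :=
  ∃ P : GL (Fin r) (valRing K), A = (P : Matrix (Fin r) (Fin r) (valRing K)).map Subtype.val

/-- `D_μ = diag(t ^ μ₁, …, t ^ μ_r)`. -/
noncomputable def diagT (K : Type*) [Field K] {r : ℕ} (μ : Fin r → ℝ) : FMat K r :=
  Matrix.diagonal fun i => tPow K (μ i)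

/-- `ν̂ = (ν_r, …, ν₁)`. -/
def hat {r : ℕ} (ν : Fin r → ℝ) : Fin r → ℝ := fun i => ν i.rev

/-- Upper triangular matrices. -/
def IsUpper {K : Type*} [Field K] {r : ℕ} (A : FMat K r) : Prop := ∀ i j, j < i → A i j = 0

/-- Lower triangular matrices. -/
def IsLower {K : Type*} [Field K] {r : ℕ} (A : FMat K r) : Prop := ∀ i j, i < j → A i j = 0

/-- `Q ∈ GL_r(R)` is `μ`-admissible: `D_μ Q D_μ⁻¹ ∈ GL_r(R)`. -/
def IsLeftAdmissible {K : Type*} [Field K] {r : ℕ} (μ : Fin r → ℝ) (Q : FMat K r) : Prop :=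
  InGLR Q ∧ InGLR (diagT K μ * Q * (diagT K μ)⁻¹)

/-- `T ∈ GL_r(R)` is `ν̂`-admissible: `D_ν̂⁻¹ T D_ν̂ ∈ GL_r(R)`. -/
def IsRightAdmissible {K : Type*} [Field K] {r : ℕ} (ν : Fin r → ℝ) (T : FMat K r) : Prop :=
  InGLR T ∧ InGLR ((diagT K (hat ν))⁻¹ * T * diagT K (hat ν))

/-! ### Index sets and orders of minors -/

/-- Index sets of length `k`: increasing sequences `i₁ < ⋯ < i_k` in `{1, …, r}`. -/
abbrev IdxSet (k r : ℕ) : Type := Fin k ↪o Fin r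

/-- `I ⊆ H` for index sets of the same length: `i_s ≤ h_s` for all `s`. -/
def IdxLE {k r : ℕ} (I H : IdxSet k r) : Prop := ∀ s, I s ≤ H s

/-- The order `‖A_{IJ}‖` of the minor of `A` with rows `I` and columns `J`. -/
noncomputable def minorOrd {K : Type*} [Field K] {k r : ℕ} (A : FMat K r) (I J : IdxSet k r) :
    WithTop ℝ :=
  sOrd (A.submatrix I J).det

/-- `|μ_I| = μ_{i₁} + ⋯ + μ_{i_k}`. -/
def idxSum {k r : ℕ} (μ : Fin r → ℝ) (I : IdxSet k r) : ℝ := ∑ s, μ (I s)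

/-- `‖A_{HJ}‖ ≤ ‖A_{IJ}‖ + |μ_I| - |μ_H|` whenever `I ⊆ H`. -/
def RowGapIneq {K : Type*} [Field K] {r : ℕ} (μ : Fin r → ℝ) (A : FMat K r) : Prop :=
  ∀ (k : ℕ) (I H J : IdxSet k r), IdxLE I H →
    minorOrd A H J ≤ minorOrd A I J + ((idxSum μ I - idxSum μ H : ℝ) : WithTop ℝ)

/-- `‖A_{IH}‖ ≤ ‖A_{IJ}‖ + |ν̂_J| - |ν̂_H|` whenever `H ⊆ J`. -/
def ColGapIneq {K : Type*} [Field K] {r : ℕ} (ν : Fin r → ℝ) (A : FMat K r) : Prop :=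
  ∀ (k : ℕ) (I H J : IdxSet k r), IdxLE H J →
    minorOrd A I H ≤ minorOrd A I J + ((idxSum (hat ν) J - idxSum (hat ν) H : ℝ) : WithTop ℝ)

/-- `‖A_{IJ}‖ ≤ ‖A_{HJ}‖` whenever `I ⊆ H`. -/
def RowIneq {K : Type*} [Field K] {r : ℕ} (A : FMat K r) : Prop :=
  ∀ (k : ℕ) (I H J : IdxSet k r), IdxLE I H → minorOrd A I J ≤ minorOrd A H J

/-- `‖A_{IJ}‖ ≤ ‖A_{IH}‖` whenever `H ⊆ J`. For upper triangular `A` this is a condition only when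
`I ⊆ H ⊆ J`, since `A_{IH} = 0` unless `I ⊆ H`. -/
def ColIneq {K : Type*} [Field K] {r : ℕ} (A : FMat K r) : Prop :=
  ∀ (k : ℕ) (I H J : IdxSet k r), IdxLE H J → minorOrd A I J ≤ minorOrd A I H

/-- The row inequality for a lower triangular matrix, whose minors `A_{IJ}` vanish identically
unless `J ⊆ I`: `‖A_{IJ}‖ ≤ ‖A_{HJ}‖` whenever `J ⊆ I ⊆ H`. -/
def LowerRowIneq {K : Type*} [Field K] {r : ℕ} (A : FMat K r) : Prop :=
  ∀ (k : ℕ) (I H J : IdxSet k r), IdxLE J I → IdxLE I H → minorOrd A I J ≤ minorOrd A H J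

/-- The column inequality for a lower triangular matrix: `‖A_{IJ}‖ ≤ ‖A_{IH}‖` whenever
`H ⊆ J ⊆ I`. -/
def LowerColIneq {K : Type*} [Field K] {r : ℕ} (A : FMat K r) : Prop :=
  ∀ (k : ℕ) (I H J : IdxSet k r), IdxLE H J → IdxLE J I → minorOrd A I J ≤ minorOrd A I H

/-! ### Pair equivalence, generic matrices and fillings -/

/-- `(A, B) = (P M Q⁻¹, Q N T⁻¹)` for some `P, Q, T ∈ GL_r(R)`. -/
def PairEquiv {K : Type*} [Field K] {r : ℕ} (M N A B : FMat K r) : Prop :=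
  ∃ P Q T : FMat K r, InGLR P ∧ InGLR Q ∧ InGLR T ∧ A = P * M * Q⁻¹ ∧ B = Q * N * T⁻¹

/-- `N'` is a `μ`-generic matrix associated to `N`: it is upper triangular and `N' = Q N T⁻¹`, where
`Q = Q_U Q_L = Q̂_L Q̂_U` is `μ`-admissible, left multiplication by `Q` gives the two row inequalities
for `Q N`, and right multiplication by `T⁻¹` gives the column inequality for `N' = (Q N) T⁻¹`. -/
def IsMuGenericFor {K : Type*} [Field K] {r : ℕ} (μ : Fin r → ℝ) (N N' : FMat K r) : Prop :=
  IsUpper N' ∧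
  ∃ Q T : FMat K r, IsLeftAdmissible μ Q ∧ InGLR T ∧ N' = Q * N * T⁻¹ ∧
    (∃ QU QL : FMat K r, InGLR QU ∧ InGLR QL ∧ IsUpper QU ∧ IsLower QL ∧ Q = QU * QL) ∧
    (∃ QL QU : FMat K r, InGLR QL ∧ InGLR QU ∧ IsLower QL ∧ IsUpper QU ∧ Q = QL * QU) ∧
    RowIneq (Q * N) ∧ RowGapIneq μ (Q * N) ∧ ColIneq N'

/-- `N'` is `μ`-generic: it is associated to some invertible matrix over `F`. -/
def IsMuGeneric {K : Type*} [Field K] {r : ℕ} (μ : Fin r → ℝ) (N' : FMat K r) : Prop :=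
  ∃ N : FMat K r, IsUnit N ∧ IsMuGenericFor μ N N'

/-- `L` is `μ`-`ν̂`-generic: it is a lower triangular matrix in `GL_r(R)` which factors as
`L = Q_L Q_U S T_U T_L` in `GL_r(R)`, with `Q_L Q_U` `μ`-admissible and `T_U T_L` `ν̂`-admissible, so
that the row inequalities hold for `Q_L Q_U` acting on `S T_U T_L` and the column inequalities hold
for `T_U T_L` acting on `Q_L Q_U S`; both products are `L`. -/
def IsMuNuGeneric {K : Type*} [Field K] {r : ℕ} (μ ν : Fin r → ℝ) (L : FMat K r) : Prop :=
  InGLR L ∧ IsLower L ∧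
  (∃ QL QU S TU TL : FMat K r,
    InGLR QL ∧ InGLR QU ∧ InGLR S ∧ InGLR TU ∧ InGLR TL ∧
    IsLower QL ∧ IsUpper QU ∧ IsUpper TU ∧ IsLower TL ∧
    IsLeftAdmissible μ (QL * QU) ∧ IsRightAdmissible ν (TU * TL) ∧
    L = QL * QU * S * TU * TL) ∧
  LowerRowIneq L ∧ RowGapIneq μ L ∧ LowerColIneq L ∧ ColGapIneq ν L

/-- The set of rows that remain when the rows `p, p + 1, …, q` (counted from `1`) are omitted; all
rows if `p > q`. -/
def keptRows (r p q : ℕ) : Finset (Fin r) :=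
  Finset.univ.filter fun a => ¬ (p ≤ (a : ℕ) + 1 ∧ (a : ℕ) + 1 ≤ q)

/-- The `k` right-most columns. -/
def rightCols {k r : ℕ} (h : k ≤ r) : IdxSet k r :=
  OrderEmbedding.ofStrictMono (fun s => ⟨r - k + (s : ℕ), by have := s.2; omega⟩)
    (fun a b hab => by
      have h1 : (a : ℕ) < b := hab
      change r - k + (a : ℕ) < r - k + (b : ℕ)
      omega)

theorem Finset.card_le_of_fin {r : ℕ} (S : Finset (Fin r)) : S.card ≤ r := by
  simpa using S.card_le_univ

/-- `‖(p^, …, q^)‖`: the order of the minor of `A` whose rows are all the rows except `p, …, q`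
(counted from `1`) and whose columns are the right-most ones. (The minors used below are nonzero, so
that the order is a real number.) -/
noncomputable def omitOrd {K : Type*} [Field K] {r : ℕ} (A : FMat K r) (p q : ℕ) : ℝ :=
  (minorOrd A ((keptRows r p q).orderEmbOfFin rfl)
    (rightCols (Finset.card_le_of_fin (keptRows r p q)))).untopD 0

/-- `‖((j-i)^, …, (j-1)^)‖ - ‖((j-i+1)^, …, j^)‖`, with `i`, `j` counted from `1` and `i ≤ j`; this is
the value of `k_{1j} + ⋯ + k_{ij}` (and it is `0` for `i = 0`). -/
noncomputable def partialSum {K : Type*} [Field K] {r : ℕ} (A : FMat K r) (i j : ℕ) : ℝ :=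
  omitOrd A (j - i) (j - 1) - omitOrd A (j - i + 1) j

/-- `k` is the right filling of the pair `(M, N)`: for some `μ`-generic pair `(D_μ, N')` in the orbit
of `(M, N)`, the parts `k_{ij}`, `i ≤ j`, are given by the determinantal formula for `N'`.
(`Fin r` counts from `0`: `k i j` is the part with indices `i + 1`, `j + 1`.) -/
def IsRightFilling {K : Type*} [Field K] {r : ℕ} (M N : FMat K r) (k : Fin r → Fin r → ℝ) : Prop :=
  ∃ (μ : Fin r → ℝ) (N' : FMat K r), Antitone μ ∧ IsMuGeneric μ N' ∧
    PairEquiv M N (diagT K μ) N' ∧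
    ∀ i j : Fin r, i ≤ j → k i j = partialSum N' (i + 1) (j + 1) - partialSum N' i (j + 1)

/-- `m` is the left filling of the pair `(M, N)`, obtained by exchanging the roles of the two
matrices and of rows and columns: the right filling of the pair `(Nᵀ, Mᵀ)`. -/
def IsLeftFilling {K : Type*} [Field K] {r : ℕ} (M N : FMat K r) (m : Fin r → Fin r → ℝ) : Prop :=
  IsRightFilling N.transpose M.transpose m

/-- `(ν₁, …, ν_σ, α, 0, …, 0)`. -/
noncomputable def truncPart {r : ℕ} (ν : Fin r → ℝ) (σ : ℕ) (α : ℝ) : Fin r → ℝ := fun i =>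
  if (i : ℕ) < σ then ν i else if (i : ℕ) = σ then α else 0

section

variable {K : Type*} [Field K]

/-! ### The order function -/

/-! The entries of a right filling of $(D_\mu, LD_\rho)$ can be read off from $L$ itself. Suppose
that among the minors of $LD_\rho$ of size $k$ the one in the left-most columns has least order for
every choice of rows. Then for every row set $I$ the right-most minor of a $\mu$-generic $N^*$ in
the orbit has order $\|L_{I,\mathrm{left}}\|+\rho_1+\dots+\rho_k$ (`IsMuGeneric.minorOrd_rightCols`,
`IsRowGeneric.omitOrd_eq`). Both sides are row-wise minima of orders of minors, a right factor in
$GL_r(R)$ cannot lower them, and the two row inequalities are exactly what a left factor respecting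
$D_\mu$ needs in order not to lower them either (`le_minorOrd_mul_of_gap`, through a rearrangement
inequality). Applying this to $Q$ and to $Q^{-1}$ gives equality.

In the formula for $k_{ij}$ the sums of $\rho$ cancel off the diagonal and leave a single part of
$\rho$ on it: $k_{ij}$ is a quantity depending only on $L$, plus $\nu_i$ if $i=j$ and
$\rho=\widehat\nu$ (`IsRightFilling.eq_leftPart_add`). Only minors of size at least $r-i$ occur. For
$i\le\sigma$, truncating $\nu$ changes $\widehat\nu$ only in its first $r-\sigma\le r-i$ positions,
and only downwards, so left-most minors of these sizes stay minimal, while $\nu_i$ is unchanged.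

The statement on left fillings follows by reflecting $L$ in its antidiagonal, which exchanges $\mu$
with $\nu$ and row with column inequalities (`pairEquiv_antiTranspose`). -/

theorem sOrd_mul (a b : sparseSeries K) : sOrd (a * b) = sOrd a + sOrd b :=
  HahnSeries.orderTop_mul (a : HahnSeries ℝ K) (b : HahnSeries ℝ K)

theorem sOrd_zero : sOrd (0 : sparseSeries K) = ⊤ :=
  HahnSeries.orderTop_zero

theorem sOrd_one : sOrd (1 : sparseSeries K) = 0 :=
  HahnSeries.orderTop_one

theorem sOrd_neg (a : sparseSeries K) : sOrd (-a) = sOrd a :=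
  HahnSeries.orderTop_neg

theorem sOrd_ne_top {a : sparseSeries K} (h : a ≠ 0) : sOrd a ≠ ⊤ := by
  rw [sOrd, HahnSeries.orderTop_ne_top]
  exact fun h0 => h (Subtype.ext h0)

theorem sOrd_tPow (s : ℝ) : sOrd (tPow K s) = (s : WithTop ℝ) :=
  HahnSeries.orderTop_single one_ne_zero

theorem le_sOrd_sum {ι : Type*} (s : Finset ι) (f : ι → sparseSeries K) {c : WithTop ℝ}
    (h : ∀ i ∈ s, c ≤ sOrd (f i)) : c ≤ sOrd (∑ i ∈ s, f i) := by
  classical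
  induction s using Finset.induction_on with
  | empty => simp [sOrd_zero]
  | insert a s ha ih =>
    rw [Finset.sum_insert ha]
    exact (le_min (h a (Finset.mem_insert_self a s))
      (ih fun i hi => h i (Finset.mem_insert_of_mem hi))).trans
        HahnSeries.min_orderTop_le_orderTop_add

theorem sOrd_prod {ι : Type*} (s : Finset ι) (f : ι → sparseSeries K) :
    sOrd (∏ i ∈ s, f i) = ∑ i ∈ s, sOrd (f i) := by
  classical
  induction s using Finset.induction_on with
  | empty => simp [sOrd_one]
  | insert a s ha ih => rw [Finset.prod_insert ha, Finset.sum_insert ha, sOrd_mul, ih]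

theorem sOrd_sign_mul (e : ℤˣ) (a : sparseSeries K) :
    sOrd (((e : ℤ) : sparseSeries K) * a) = sOrd a := by
  rcases Int.units_eq_one_or e with rfl | rfl <;> simp [sOrd_neg]

/-! ### Matrices over the valuation ring -/

section InGLR

variable {r : ℕ}

theorem InGLR.zero_le_sOrd {A : FMat K r} (h : InGLR A) (i j : Fin r) : 0 ≤ sOrd (A i j) := by
  obtain ⟨P, rfl⟩ := h
  exact (P i j).2

theorem InGLR.of_mul_eq_one {P Q : Matrix (Fin r) (Fin r) (valRing K)} (h : P * Q = 1) :
    InGLR (P.map Subtype.val) :=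
  ⟨⟨P, Q, h, mul_eq_one_comm.1 h⟩, rfl⟩

theorem map_val_mul (P Q : Matrix (Fin r) (Fin r) (valRing K)) :
    (P * Q).map Subtype.val = P.map Subtype.val * Q.map (Subtype.val : _ → sparseSeries K) :=
  Matrix.map_mul (f := (valRing K).subtype)

theorem map_val_one :
    (1 : Matrix (Fin r) (Fin r) (valRing K)).map Subtype.val = (1 : FMat K r) :=
  Matrix.map_one _ rfl rfl

theorem InGLR.exists_inv {A : FMat K r} (h : InGLR A) : ∃ B, InGLR B ∧ A * B = 1 := by
  obtain ⟨P, rfl⟩ := h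
  refine ⟨_, ⟨P⁻¹, rfl⟩, ?_⟩
  rw [← map_val_mul, ← Units.val_mul, mul_inv_cancel, Units.val_one, map_val_one]

theorem InGLR.mul_inv {A : FMat K r} (h : InGLR A) : A * A⁻¹ = 1 := by
  obtain ⟨B, -, hB⟩ := h.exists_inv
  rw [Matrix.inv_eq_right_inv hB, hB]

theorem InGLR.inv_mul {A : FMat K r} (h : InGLR A) : A⁻¹ * A = 1 :=
  mul_eq_one_comm.1 h.mul_inv

theorem InGLR.inv {A : FMat K r} (h : InGLR A) : InGLR A⁻¹ := by
  obtain ⟨B, hB, h1⟩ := h.exists_inv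
  rwa [Matrix.inv_eq_right_inv h1]

theorem InGLR.one : InGLR (1 : FMat K r) := ⟨1, by rw [Units.val_one, map_val_one]⟩

theorem InGLR.mul {A B : FMat K r} (hA : InGLR A) (hB : InGLR B) : InGLR (A * B) := by
  obtain ⟨P, rfl⟩ := hA
  obtain ⟨Q, rfl⟩ := hB
  exact ⟨P * Q, by rw [Units.val_mul, map_val_mul]⟩

theorem InGLR.transpose {A : FMat K r} (h : InGLR A) : InGLR A.transpose := by
  obtain ⟨P, rfl⟩ := h
  have h1 : (P⁻¹).val * P.val = 1 := by rw [← Units.val_mul, inv_mul_cancel, Units.val_one]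
  refine InGLR.of_mul_eq_one (P := P.val.transpose) (Q := (P⁻¹).val.transpose) ?_
  rw [← Matrix.transpose_mul, h1, Matrix.transpose_one]

/-- The permutation matrix of the reversal of `{1, …, r}`. -/
def revMat (R : Type*) [CommRing R] (r : ℕ) : Matrix (Fin r) (Fin r) R :=
  (1 : Matrix (Fin r) (Fin r) R).submatrix Fin.revPerm id

theorem revMat_mul {R : Type*} [CommRing R] (A : Matrix (Fin r) (Fin r) R) :
    revMat R r * A = A.submatrix Fin.rev id := by
  ext i j
  simp [revMat, Matrix.mul_apply, Matrix.one_apply]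

theorem mul_revMat {R : Type*} [CommRing R] (A : Matrix (Fin r) (Fin r) R) :
    A * revMat R r = A.submatrix id Fin.rev := by
  ext i j
  simp [revMat, Matrix.mul_apply, Matrix.one_apply, Fin.rev_eq_iff]

theorem revMat_mul_self (R : Type*) [CommRing R] : revMat R r * revMat R r = 1 := by
  rw [revMat_mul]
  ext i j
  simp [revMat, Matrix.one_apply]

theorem InGLR.revMat : InGLR (revMat (sparseSeries K) r) := by
  have h := InGLR.of_mul_eq_one (revMat_mul_self (r := r) (valRing K))
  convert h using 1
  ext i j
  simp only [_root_.revMat, Matrix.submatrix_apply, Matrix.map_apply, Matrix.one_apply]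
  split_ifs <;> rfl

end InGLR

/-! ### Minors of products -/

section Minors

variable {k r : ℕ}

/-- Multilinearity in the rows. The sum runs over all maps `e`, not regrouped as in Cauchy–Binet,
since the later bounds use the order of each single term. -/
theorem det_submatrix_mul (A B : FMat K r) (f g : Fin k → Fin r) :
    ((A * B).submatrix f g).det =
      ∑ e : Fin k → Fin r, (∏ s, A (f s) (e s)) * (B.submatrix e g).det := by
  have h : (A * B).submatrix f g = fun s => ∑ a, A (f s) a • fun t => B a (g t) := by
    ext s t
    simp [Matrix.mul_apply, Finset.sum_apply]
  have h2 := (Matrix.detRowAlternating (R := sparseSeries K) (n := Fin k)).toMultilinearMap.map_sum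
    (fun s a => A (f s) a • fun t => B a (g t))
  rw [h]
  refine h2.trans (Finset.sum_congr rfl fun e _ => ?_)
  exact (Matrix.detRowAlternating (R := sparseSeries K)
    (n := Fin k)).toMultilinearMap.map_smul_univ (fun s => A (f s) (e s)) (fun s t => B (e s) (g t))

theorem exists_idxSet_comp_perm {e : Fin k → Fin r} (he : Function.Injective e) :
    ∃ (S : IdxSet k r) (π : Equiv.Perm (Fin k)), ∀ s, e s = S (π s) := by
  refine ⟨OrderEmbedding.ofStrictMono (e ∘ Tuple.sort e)
    ((Tuple.monotone_sort e).strictMono_of_injective (he.comp (Tuple.sort e).injective)),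
    (Tuple.sort e).symm, fun s => ?_⟩
  simp

theorem sOrd_det_submatrix_perm (B : FMat K r) (S J : IdxSet k r) (π : Equiv.Perm (Fin k)) :
    sOrd (B.submatrix (fun s => S (π s)) J).det = minorOrd B S J := by
  have h := Matrix.det_permute π (B.submatrix S J)
  rw [minorOrd, ← sOrd_sign_mul (Equiv.Perm.sign π) (B.submatrix S J).det, ← h]
  rfl

theorem minorOrd_transpose (A : FMat K r) (I J : IdxSet k r) :
    minorOrd A.transpose I J = minorOrd A J I := by
  rw [minorOrd, minorOrd, ← Matrix.transpose_submatrix, Matrix.det_transpose]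

/-- A lower bound for the orders of the minors of a product: it suffices to bound the terms of its
expansion along the rows of the left factor. -/
theorem le_minorOrd_mul {A B : FMat K r} {I J : IdxSet k r} {c : WithTop ℝ}
    (h : ∀ (S : IdxSet k r) (π : Equiv.Perm (Fin k)),
      c ≤ ∑ s, sOrd (A (I s) (S (π s))) + minorOrd B S J) : c ≤ minorOrd (A * B) I J := by
  rw [minorOrd, det_submatrix_mul]
  refine le_sOrd_sum _ _ fun e _ => ?_
  rw [sOrd_mul, sOrd_prod]
  by_cases he : Function.Injective e
  · obtain ⟨S, π, h1⟩ := exists_idxSet_comp_perm he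
    obtain rfl : e = fun s => S (π s) := funext h1
    rw [sOrd_det_submatrix_perm]
    exact h S π
  · obtain ⟨a, b, hab, hne⟩ : ∃ a b, e a = e b ∧ a ≠ b := by
      simpa [Function.Injective] using he
    rw [Matrix.det_zero_of_row_eq hne (by ext t; simp [hab]), sOrd_zero, add_top]
    exact le_top

theorem le_minorOrd_mul_of_left {A B : FMat K r} (hA : ∀ i j, 0 ≤ sOrd (A i j))
    {I J : IdxSet k r} {c : WithTop ℝ} (h : ∀ S, c ≤ minorOrd B S J) :
    c ≤ minorOrd (A * B) I J :=
  le_minorOrd_mul fun S _ => (h S).trans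
    (le_add_of_nonneg_left (Finset.sum_nonneg fun _ _ => hA _ _))

theorem le_minorOrd_mul_of_right {A B : FMat K r} (hB : ∀ i j, 0 ≤ sOrd (B i j))
    {I J : IdxSet k r} {c : WithTop ℝ} (h : ∀ S, c ≤ minorOrd A I S) :
    c ≤ minorOrd (A * B) I J := by
  rw [← minorOrd_transpose, Matrix.transpose_mul]
  exact le_minorOrd_mul_of_left (fun i j => hB j i) fun S => by
    rw [minorOrd_transpose]
    exact h S

theorem minorOrd_diagT_mul (μ : Fin r → ℝ) (A : FMat K r) (I J : IdxSet k r) :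
    minorOrd (diagT K μ * A) I J = (idxSum μ I : ℝ) + minorOrd A I J := by
  have h : (diagT K μ * A).submatrix I J =
      Matrix.of fun s t => tPow K (μ (I s)) * (A.submatrix I J) s t := by
    ext s t
    simp [diagT, Matrix.diagonal_mul]
  rw [minorOrd, h, Matrix.det_mul_column, sOrd_mul, sOrd_prod, minorOrd, idxSum]
  simp [sOrd_tPow]

theorem diagT_transpose (μ : Fin r → ℝ) : (diagT K μ).transpose = diagT K μ :=
  Matrix.diagonal_transpose _

theorem minorOrd_mul_diagT (μ : Fin r → ℝ) (A : FMat K r) (I J : IdxSet k r) :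
    minorOrd (A * diagT K μ) I J = minorOrd A I J + (idxSum μ J : ℝ) := by
  rw [← minorOrd_transpose, Matrix.transpose_mul, diagT_transpose, minorOrd_diagT_mul,
    minorOrd_transpose, add_comm]

end Minors

/-! ### A rearrangement inequality -/

/-- Submodularity of `max`: the exchange step of the rearrangement inequality. -/
theorem max_add_max_le {a a' b b' : ℝ} (ha : a' ≤ a) (hb : b' ≤ b) :
    max a b + max a' b' ≤ max a b' + max a' b := by
  rcases le_total a b with h1 | h1 <;> rcases le_total a' b' with h2 | h2 <;>
    rcases le_total a b' with h3 | h3 <;> rcases le_total a' b with h4 | h4 <;>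
    simp only [max_eq_left, max_eq_right, h1, h2, h3, h4] <;> linarith

/-- Undoing an inversion never increases a sum of maxima, so the matching of two decreasing
sequences in order is the cheapest. Induction on `k`, splitting off the image of `0` under `π`. -/
theorem Antitone.sum_max_le_sum_max_comp_perm {k : ℕ} {a b : Fin k → ℝ} (ha : Antitone a)
    (hb : Antitone b) (π : Equiv.Perm (Fin k)) :
    ∑ s, max (a s) (b s) ≤ ∑ s, max (a s) (b (π s)) := by
  induction k with
  | zero => simp
  | succ k ih =>
    obtain ⟨⟨p, e⟩, rfl⟩ := Equiv.Perm.decomposeFin.symm.surjective π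
    have h0 := ih (a := fun s => a s.succ) (b := fun s => b s.succ)
      (fun _ _ h => ha (Fin.succ_le_succ_iff.2 h)) (fun _ _ h => hb (Fin.succ_le_succ_iff.2 h)) e
    rw [Fin.sum_univ_succ, Fin.sum_univ_succ]
    simp only [Equiv.Perm.decomposeFin_symm_apply_zero, Equiv.Perm.decomposeFin_symm_apply_succ]
    refine (add_le_add_right h0 _).trans ?_
    cases p using Fin.cases with
    | zero => simp
    | succ q =>
      -- If `0` is sent to `q.succ`, the index sent to `0` is `(e.symm q).succ`. Exchanging these
      -- two images restores the matching of `0` with `0`; the other terms are unaffected.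
      rw [← Finset.add_sum_erase _ _ (Finset.mem_univ (e.symm q)),
        ← Finset.add_sum_erase _ (fun s => max (a s.succ) (b (Equiv.swap 0 q.succ (e s).succ)))
          (Finset.mem_univ (e.symm q)), ← add_assoc, ← add_assoc]
      simp only [Equiv.apply_symm_apply, Equiv.swap_apply_right]
      refine add_le_add (max_add_max_le (ha (Fin.zero_le _)) (hb (Fin.zero_le _)))
        (Finset.sum_le_sum fun s hs => le_of_eq ?_)
      rw [Equiv.swap_apply_of_ne_of_ne (Fin.succ_ne_zero _)]
      intro h
      exact Finset.ne_of_mem_erase hs (by rw [← Fin.succ_injective _ h, Equiv.symm_apply_apply])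

/-! ### Index sets -/

section IdxSet

variable {k r : ℕ}

/-- The `k` left-most columns. -/
def leftCols (h : k ≤ r) : IdxSet k r := Fin.castLEOrderEmb h

/-- The image of an index set under the reversal of `{1, …, r}`. -/
def revIdx (I : IdxSet k r) : IdxSet k r :=
  OrderEmbedding.ofStrictMono (fun s => (I s.rev).rev) fun _ _ h =>
    Fin.rev_lt_rev.2 (I.strictMono (Fin.rev_lt_rev.2 h))

theorem revIdx_apply (I : IdxSet k r) (s : Fin k) : revIdx I s = (I s.rev).rev := rfl

/-- The componentwise minimum of two index sets. -/
def minIdx (I H : IdxSet k r) : IdxSet k r :=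
  OrderEmbedding.ofStrictMono (fun s => min (I s) (H s)) fun _ _ h =>
    min_lt_min (I.strictMono h) (H.strictMono h)

theorem minIdx_apply (I H : IdxSet k r) (s : Fin k) : minIdx I H s = min (I s) (H s) := rfl

theorem IdxLE.revIdx {I H : IdxSet k r} (h : IdxLE I H) : IdxLE (revIdx H) (revIdx I) :=
  fun s => Fin.rev_le_rev.2 (h s.rev)

theorem leftCols_le (h : k ≤ r) (I : IdxSet k r) : IdxLE (leftCols h) I := by
  have h1 : ∀ (n : ℕ) (hn : n < k), n ≤ (I ⟨n, hn⟩ : ℕ) := by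
    intro n
    induction n with
    | zero => intro _; exact Nat.zero_le _
    | succ n ih =>
      intro hn
      have h2 : I ⟨n, by omega⟩ < I ⟨n + 1, hn⟩ := I.strictMono (Fin.lt_def.2 (Nat.lt_succ_self n))
      have h3 := ih (by omega)
      have h4 := Fin.lt_def.1 h2
      omega
  exact fun s => Fin.le_def.2 (h1 s s.2)

theorem rightCols_eq_revIdx (h : k ≤ r) : rightCols h = revIdx (leftCols h) := by
  ext s
  have h1 := s.2
  change r - k + (s : ℕ) = r - (k - ((s : ℕ) + 1) + 1)
  omega

theorem revIdx_revIdx (I : IdxSet k r) : revIdx (revIdx I) = I := by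
  ext s
  simp [revIdx_apply]

theorem le_rightCols (h : k ≤ r) (I : IdxSet k r) : IdxLE I (rightCols h) := by
  have h1 := (leftCols_le h (revIdx I)).revIdx
  rwa [revIdx_revIdx, ← rightCols_eq_revIdx] at h1

theorem idxSum_le_idxSum {μ : Fin r → ℝ} (hμ : Antitone μ) {I H : IdxSet k r} (h : IdxLE I H) :
    idxSum μ H ≤ idxSum μ I :=
  Finset.sum_le_sum fun s _ => hμ (h s)

theorem idxSum_hat (μ : Fin r → ℝ) (I : IdxSet k r) : idxSum (hat μ) I = idxSum μ (revIdx I) := by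
  simp only [idxSum, hat, revIdx_apply]
  exact (Equiv.sum_comp Fin.revPerm fun s => μ (I s).rev).symm

theorem idxSum_sub (μ ν : Fin r → ℝ) (I : IdxSet k r) :
    idxSum (fun i => μ i - ν i) I = idxSum μ I - idxSum ν I :=
  Finset.sum_sub_distrib ..

/-- The sum of the first `k` entries. -/
def leadSum (ρ : Fin r → ℝ) (k : ℕ) : ℝ := ∑ i ∈ Finset.univ.filter fun i : Fin r => (i : ℕ) < k, ρ i

theorem idxSum_eq_sum_map (ρ : Fin r → ℝ) (I : IdxSet k r) :
    idxSum ρ I = ∑ i ∈ Finset.univ.map I.toEmbedding, ρ i := by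
  rw [Finset.sum_map]
  rfl

theorem idxSum_leftCols (ρ : Fin r → ℝ) (h : k ≤ r) : idxSum ρ (leftCols h) = leadSum ρ k := by
  rw [idxSum_eq_sum_map, leadSum]
  congr 1
  ext i
  simp only [Finset.mem_map, Finset.mem_univ, true_and, Finset.mem_filter]
  constructor
  · rintro ⟨s, rfl⟩
    exact s.2
  · exact fun hi => ⟨⟨i, hi⟩, rfl⟩

theorem leadSum_succ (ρ : Fin r → ℝ) (h : k < r) :
    leadSum ρ (k + 1) = leadSum ρ k + ρ ⟨k, h⟩ := by
  have h1 : (Finset.univ.filter fun i : Fin r => (i : ℕ) < k + 1) =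
      insert ⟨k, h⟩ (Finset.univ.filter fun i : Fin r => (i : ℕ) < k) := by
    ext i
    simp only [Finset.mem_filter, Finset.mem_univ, true_and, Finset.mem_insert, Fin.ext_iff]
    omega
  rw [leadSum, h1, Finset.sum_insert (by simp), add_comm]
  rfl

/-- All the mass of `d` lies in the first `k` positions. -/
theorem idxSum_le_idxSum_leftCols {d : Fin r → ℝ} (hd : ∀ i, 0 ≤ d i) (h : k ≤ r)
    (hk : ∀ i : Fin r, k ≤ (i : ℕ) → d i = 0) (J : IdxSet k r) :
    idxSum d J ≤ idxSum d (leftCols h) := by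
  rw [idxSum_leftCols, idxSum_eq_sum_map, leadSum]
  refine (Finset.sum_le_univ_sum_of_nonneg hd).trans (le_of_eq ?_)
  rw [Finset.sum_filter]
  refine Finset.sum_congr rfl fun i _ => ?_
  split_ifs with hi
  · rfl
  · exact hk i (not_lt.1 hi)

theorem card_keptRows {p q n : ℕ} (hp : 1 ≤ p) (hpq : p + n = q + 1) (hq : q ≤ r) :
    (keptRows r p q).card = r - n := by
  have h1 : keptRows r p q = (Finset.univ.filter fun a : Fin r =>
      p ≤ (a : ℕ) + 1 ∧ (a : ℕ) + 1 ≤ q)ᶜ := by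
    ext a
    simp [keptRows]
  have h2 : ((Finset.univ.filter fun a : Fin r => p ≤ (a : ℕ) + 1 ∧ (a : ℕ) + 1 ≤ q).map
      Fin.valEmbedding) = Finset.Ico (p - 1) q := by
    ext b
    simp only [Finset.mem_map, Finset.mem_filter, Finset.mem_univ, true_and,
      Fin.valEmbedding_apply, Finset.mem_Ico]
    constructor
    · rintro ⟨a, h, rfl⟩
      omega
    · intro h
      exact ⟨⟨b, by omega⟩, by simp only; omega, rfl⟩
  have h3 := congrArg Finset.card h2
  rw [Finset.card_map, Nat.card_Ico] at h3
  rw [h1, Finset.card_compl, h3, Fintype.card_fin]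
  omega

theorem card_keptRows_zero {q : ℕ} (hq : q ≤ r) : (keptRows r 0 q).card = r - q := by
  rw [← card_keptRows (r := r) (p := 1) (q := q) le_rfl (Nat.add_comm 1 q) hq]
  congr 1
  ext a
  simp [keptRows]

end IdxSet

/-! ### Comparison of minors under admissible transformations -/

section Compare

variable {k r : ℕ}

theorem coe_max_sub_le {x y : ℝ} {g : WithTop ℝ} (h0 : 0 ≤ g) (h : (y : WithTop ℝ) ≤ g + x) :
    ((max x y - x : ℝ) : WithTop ℝ) ≤ g := by
  induction g using WithTop.recTopCoe with
  | top => exact le_top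
  | coe g =>
    norm_cast at h h0 ⊢
    rw [sub_le_iff_le_add]
    exact max_le (by linarith) h

/-- The row sets `S` and `I` are compared through their componentwise minimum: passing from `S` down
to it does not increase `a`, and passing up to `I` costs at most a difference of sums of $\mu$. The
entries of `G` pay for that difference, since $\|G_{ij}\|\ge\max(0,\mu_j-\mu_i)$. -/
theorem le_minorOrd_mul_of_gap {μ : Fin r → ℝ} (hμ : Antitone μ) {G A : FMat K r}
    (hG0 : ∀ i j, 0 ≤ sOrd (G i j)) (hG : ∀ i j, (μ j : WithTop ℝ) ≤ sOrd (G i j) + μ i)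
    {a : IdxSet k r → WithTop ℝ} (hmono : ∀ I H, IdxLE I H → a I ≤ a H)
    (hgap : ∀ I H, IdxLE I H → a H ≤ a I + ((idxSum μ I - idxSum μ H : ℝ) : WithTop ℝ))
    (ha : ∀ S J, a S ≤ minorOrd A S J) (I J : IdxSet k r) : a I ≤ minorOrd (G * A) I J := by
  refine le_minorOrd_mul fun S π => ?_
  -- As `μ` decreases, its values on `minIdx S I` are the maxima of its values on `S` and `I`;
  -- rearrangement then covers every `π` at once.
  have h1 : idxSum μ (minIdx S I) - idxSum μ I ≤ ∑ s, (max (μ (I s)) (μ (S (π s))) - μ (I s)) := by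
    have h := Antitone.sum_max_le_sum_max_comp_perm (hμ.comp_monotone I.monotone)
      (hμ.comp_monotone S.monotone) π
    rw [Finset.sum_sub_distrib]
    refine sub_le_sub_right (le_trans (le_of_eq ?_) h) _
    refine Finset.sum_congr rfl fun s _ => ?_
    rw [minIdx_apply, hμ.map_min, max_comm]
    rfl
  have h2 : ((∑ s, (max (μ (I s)) (μ (S (π s))) - μ (I s)) : ℝ) : WithTop ℝ) ≤
      ∑ s, sOrd (G (I s) (S (π s))) := by
    rw [WithTop.coe_sum]
    exact Finset.sum_le_sum fun s _ => coe_max_sub_le (hG0 _ _) (hG _ _)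
  calc a I ≤ a (minIdx S I) + ((idxSum μ (minIdx S I) - idxSum μ I : ℝ) : WithTop ℝ) :=
        hgap _ _ fun s => min_le_right _ _
    _ ≤ a S + ∑ s, sOrd (G (I s) (S (π s))) :=
        add_le_add (hmono _ _ fun s => min_le_left _ _)
          ((WithTop.coe_le_coe.2 h1).trans h2)
    _ ≤ _ := by
        rw [add_comm]
        gcongr
        exact ha S J

/-- Entrywise form of admissibility: $D_\mu QD_\mu^{-1}$ has entries in $R$. -/
theorem diagT_gap {μ : Fin r → ℝ} {P Q : FMat K r} (hP : ∀ i j, 0 ≤ sOrd (P i j))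
    (h : diagT K μ * Q = P * diagT K μ) (i j : Fin r) :
    (μ j : WithTop ℝ) ≤ sOrd (Q i j) + μ i := by
  have h1 := congrArg sOrd (congrFun (congrFun h i) j)
  rw [diagT, Matrix.diagonal_mul, Matrix.mul_diagonal, sOrd_mul, sOrd_mul, sOrd_tPow,
    sOrd_tPow] at h1
  rw [add_comm, h1]
  exact le_add_of_nonneg_left (hP i j)

/-- The orders of the right-most minors of a `μ`-generic matrix are determined by any other matrix
in the orbit whose minimal minors satisfy the row inequalities. -/
theorem IsMuGeneric.minorOrd_rightCols {μ : Fin r → ℝ} (hμ : Antitone μ) {A N' : FMat K r}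
    (hN : IsMuGeneric μ N') (hA : PairEquiv (diagT K μ) A (diagT K μ) N') (hk : k ≤ r)
    {J₀ : IdxSet k r} (hmin : ∀ I J, minorOrd A I J₀ ≤ minorOrd A I J)
    (hmono : ∀ I H, IdxLE I H → minorOrd A I J₀ ≤ minorOrd A H J₀)
    (hgap : ∀ I H, IdxLE I H →
      minorOrd A H J₀ ≤ minorOrd A I J₀ + ((idxSum μ I - idxSum μ H : ℝ) : WithTop ℝ))
    (I : IdxSet k r) : minorOrd N' I (rightCols hk) = minorOrd A I J₀ := by
  obtain ⟨N, -, -, Q', T', -, hT', hN', -, -, hrow, hrowgap, hcol⟩ := hN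
  obtain ⟨P, Q, T, hP, hQ, hT, hD, hB⟩ := hA
  have hD1 : diagT K μ * Q = P * diagT K μ := by
    conv_lhs => rw [hD]
    rw [Matrix.mul_assoc, hQ.inv_mul, Matrix.mul_one]
  have hD2 : diagT K μ * Q⁻¹ = P⁻¹ * diagT K μ := by
    calc diagT K μ * Q⁻¹ = P⁻¹ * (P * diagT K μ) * Q⁻¹ := by
          rw [← Matrix.mul_assoc, hP.inv_mul, Matrix.one_mul]
      _ = P⁻¹ * diagT K μ := by
          rw [← hD1, Matrix.mul_assoc, Matrix.mul_assoc, hQ.mul_inv, Matrix.mul_one]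
  have hmin' : ∀ S J, minorOrd N' S (rightCols hk) ≤ minorOrd N' S J :=
    fun S J => hcol k S J _ (le_rightCols hk J)
  -- The row inequalities are known for `Q' * N` and the column inequality for `N'`. These differ by
  -- a right factor in $GL_r(R)$, so row-wise minima can be carried from one to the other.
  have hQN : Q' * N = N' * T' := by
    rw [hN', Matrix.mul_assoc, hT'.inv_mul, Matrix.mul_one]
  have hQN' : ∀ S J, minorOrd N' S (rightCols hk) ≤ minorOrd (Q' * N) S J := fun S J => by
    rw [hQN]
    exact le_minorOrd_mul_of_right hT'.zero_le_sOrd (hmin' S)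
  have hAN : A = Q⁻¹ * (N' * T) := by
    rw [hB, Matrix.mul_assoc _ _ T, hT.inv_mul, Matrix.mul_one, ← Matrix.mul_assoc, hQ.inv_mul,
      Matrix.one_mul]
  refine le_antisymm ?_ ?_
  · conv_rhs => rw [hAN]
    refine le_minorOrd_mul_of_gap hμ (a := fun S => minorOrd N' S (rightCols hk))
      hQ.inv.zero_le_sOrd (diagT_gap hP.inv.zero_le_sOrd hD2) ?_ ?_ ?_ I J₀
    · intro S H hSH
      conv_rhs => rw [hN']
      exact le_minorOrd_mul_of_right hT'.inv.zero_le_sOrd fun J => by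
        exact (hQN' S J).trans (hrow k S H J hSH)
    · intro S H hSH
      -- The gap is moved to the left side as `-x`, because the bound for products needs a constant
      -- below a minor of `N'`.
      obtain ⟨x, hx⟩ : ∃ x : ℝ, x = idxSum μ S - idxSum μ H := ⟨_, rfl⟩
      have h1 : minorOrd N' H (rightCols hk) + ((-x : ℝ) : WithTop ℝ) ≤
          minorOrd N' S (rightCols hk) := by
        conv_rhs => rw [hN']
        refine le_minorOrd_mul_of_right hT'.inv.zero_le_sOrd fun J => ?_
        have h2 := add_le_add_left ((hQN' H J).trans (hrowgap k S H J hSH)) ((-x : ℝ) : WithTop ℝ)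
        rwa [← hx, add_assoc, ← WithTop.coe_add, add_neg_cancel, WithTop.coe_zero, add_zero] at h2
      have h3 := add_le_add_left h1 (x : WithTop ℝ)
      rwa [add_assoc, ← WithTop.coe_add, neg_add_cancel, WithTop.coe_zero, add_zero, hx] at h3
    · exact fun S J => le_minorOrd_mul_of_right hT.zero_le_sOrd (hmin' S)
  · rw [hB]
    refine le_minorOrd_mul_of_right hT.inv.zero_le_sOrd fun S => ?_
    exact le_minorOrd_mul_of_gap hμ (a := fun S => minorOrd A S J₀) hQ.zero_le_sOrd
      (diagT_gap hP.zero_le_sOrd hD1) hmono hgap hmin I S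

theorem zero_le_minorOrd {A : FMat K r} (hA : ∀ i j, 0 ≤ sOrd (A i j)) (I J : IdxSet k r) :
    0 ≤ minorOrd A I J := by
  rw [minorOrd, Matrix.det_apply']
  refine le_sOrd_sum _ _ fun π _ => ?_
  rw [sOrd_sign_mul, sOrd_prod]
  exact Finset.sum_nonneg fun _ _ => hA _ _

theorem minorOrd_one_self (I : IdxSet k r) : minorOrd (1 : FMat K r) I I = 0 := by
  rw [minorOrd, Matrix.submatrix_one _ I.injective, Matrix.det_one, sOrd_one]

theorem minorOrd_diagT (μ : Fin r → ℝ) (I J : IdxSet k r) :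
    minorOrd (diagT K μ) I J = (idxSum μ I : ℝ) + minorOrd (1 : FMat K r) I J := by
  rw [← minorOrd_diagT_mul, Matrix.mul_one]

/-- The sum of the `k` smallest parts is the least order of a minor of size `k`, and factors from
$GL_r(R)$ cannot lower it. -/
theorem idxSum_rightCols_le {μ μ' : Fin r → ℝ} (hμ : Antitone μ) {P Q : FMat K r}
    (hP : InGLR P) (hQ : InGLR Q) (h : diagT K μ' = P * diagT K μ * Q) (hk : k ≤ r) :
    idxSum μ (rightCols hk) ≤ idxSum μ' (rightCols hk) := by
  have h1 : ((idxSum μ (rightCols hk) : ℝ) : WithTop ℝ) ≤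
      minorOrd (diagT K μ') (rightCols hk) (rightCols hk) := by
    rw [h, Matrix.mul_assoc]
    refine le_minorOrd_mul_of_left hP.zero_le_sOrd fun S => ?_
    refine le_minorOrd_mul_of_right hQ.zero_le_sOrd fun S' => ?_
    rw [minorOrd_diagT]
    exact le_add_of_le_of_nonneg (WithTop.coe_le_coe.2 (idxSum_le_idxSum hμ (le_rightCols hk S)))
      (zero_le_minorOrd InGLR.one.zero_le_sOrd S S')
  rw [minorOrd_diagT, minorOrd_one_self, add_zero] at h1
  exact WithTop.coe_le_coe.1 h1

/-- The diagonal form of a matrix over `F` up to `GL_r(R)` is unique. -/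
theorem eq_of_diagT_eq_mul {μ μ' : Fin r → ℝ} (hμ : Antitone μ) (hμ' : Antitone μ')
    {P Q : FMat K r} (hP : InGLR P) (hQ : InGLR Q) (h : diagT K μ' = P * diagT K μ * Q) :
    μ' = μ := by
  have h' : diagT K μ = P⁻¹ * diagT K μ' * Q⁻¹ := by
    rw [h, Matrix.mul_assoc, Matrix.mul_assoc, hQ.mul_inv, Matrix.mul_one, ← Matrix.mul_assoc,
      hP.inv_mul, Matrix.one_mul]
  have h1 : ∀ k, k ≤ r → leadSum (hat μ') k = leadSum (hat μ) k := fun k hk => by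
    rw [← idxSum_leftCols _ hk, ← idxSum_leftCols _ hk, idxSum_hat, idxSum_hat,
      ← rightCols_eq_revIdx]
    exact le_antisymm (idxSum_rightCols_le hμ' hP.inv hQ.inv h' hk)
      (idxSum_rightCols_le hμ hP hQ h hk)
  ext i
  have h2 := h1 _ i.rev.2
  rw [leadSum_succ _ i.rev.2, leadSum_succ _ i.rev.2, h1 _ i.rev.2.le] at h2
  have h3 : (⟨(i.rev : ℕ), i.rev.2⟩ : Fin r).rev = i := Fin.rev_rev i
  simpa only [add_right_inj, hat, h3] using h2

end Compare

/-! ### Right fillings of `(D_μ, L D_ρ)` -/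

section Fillings

variable {k r : ℕ}

/-- The properties of a `μ`-`ν̂`-generic matrix that involve its rows only. -/
structure IsRowGeneric (μ : Fin r → ℝ) (L : FMat K r) : Prop where
  inGLR : InGLR L
  isLower : IsLower L
  rowIneq : LowerRowIneq L
  rowGapIneq : RowGapIneq μ L

theorem IsLower.diag_ne_zero {L : FMat K r} (hL : IsLower L) (h : InGLR L) (i : Fin r) :
    L i i ≠ 0 := by
  have h1 : L.det ≠ 0 := fun h0 => by
    have h2 := congrArg Matrix.det h.mul_inv
    rw [Matrix.det_mul, h0, zero_mul, Matrix.det_one] at h2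
    exact zero_ne_one h2
  rw [Matrix.det_of_isLowerTriangular L fun i j hij => hL i j hij] at h1
  exact Finset.prod_ne_zero_iff.1 h1 i (Finset.mem_univ i)

/-- The leading principal minor is a product of nonzero diagonal entries; the gap inequality carries
finiteness to every other row set. -/
theorem IsRowGeneric.minorOrd_ne_top {μ : Fin r → ℝ} {L : FMat K r} (hL : IsRowGeneric μ L)
    (h : k ≤ r) (I : IdxSet k r) : minorOrd L I (leftCols h) ≠ ⊤ := by
  have h1 : minorOrd L (leftCols h) (leftCols h) ≠ ⊤ := by
    refine sOrd_ne_top ?_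
    have h2 : (L.submatrix (leftCols h) (leftCols h)).IsLowerTriangular :=
      fun i j hij => hL.isLower _ _ ((leftCols h).strictMono (OrderDual.toDual_lt_toDual.1 hij))
    rw [Matrix.det_of_isLowerTriangular _ h2]
    exact Finset.prod_ne_zero_iff.2 fun i _ => hL.isLower.diag_ne_zero hL.inGLR _
  exact ne_top_of_le_ne_top (WithTop.add_ne_top.2 ⟨h1, WithTop.coe_ne_top⟩)
    (hL.rowGapIneq k _ I _ (leftCols_le h I))

/-- The left-most minors of length `k` of `L D_ρ` are minimal in their rows. -/
def LeftMinimal (L : FMat K r) (ρ : Fin r → ℝ) (k : ℕ) : Prop :=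
  ∀ (h : k ≤ r) (I J : IdxSet k r),
    minorOrd L I (leftCols h) + (idxSum ρ (leftCols h) : ℝ) ≤ minorOrd L I J + (idxSum ρ J : ℝ)

/-- The order of the minor of `A` whose rows are all the rows except `p, …, q` and whose columns
are the left-most ones. -/
noncomputable def omitLeftOrd (A : FMat K r) (p q : ℕ) : ℝ :=
  (minorOrd A ((keptRows r p q).orderEmbOfFin rfl)
    (leftCols (Finset.card_le_of_fin (keptRows r p q)))).untopD 0

theorem IsRowGeneric.omitOrd_eq {μ ρ : Fin r → ℝ} (hμ : Antitone μ) {L N' : FMat K r}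
    (hL : IsRowGeneric μ L) (hN : IsMuGeneric μ N')
    (hpair : PairEquiv (diagT K μ) (L * diagT K ρ) (diagT K μ) N') {p q c : ℕ}
    (hc : (keptRows r p q).card = c) (hρ : LeftMinimal L ρ c) :
    omitOrd N' p q = omitLeftOrd L p q + leadSum ρ c := by
  subst hc
  have hcard := Finset.card_le_of_fin (keptRows r p q)
  have h := hN.minorOrd_rightCols hμ hpair hcard (J₀ := leftCols hcard)
    (fun I J => by
      rw [minorOrd_mul_diagT, minorOrd_mul_diagT]
      exact hρ hcard I J)
    (fun I H hIH => by
      rw [minorOrd_mul_diagT, minorOrd_mul_diagT]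
      gcongr
      exact hL.rowIneq _ I H _ (leftCols_le hcard I) hIH)
    (fun I H hIH => by
      rw [minorOrd_mul_diagT, minorOrd_mul_diagT, add_right_comm]
      gcongr
      exact hL.rowGapIneq _ I H _ hIH)
    ((keptRows r p q).orderEmbOfFin rfl)
  rw [omitOrd, h, minorOrd_mul_diagT, omitLeftOrd, idxSum_leftCols]
  -- Finiteness makes `untopD 0` compatible with adding the sum of `ρ`.
  obtain ⟨x, hx⟩ := WithTop.ne_top_iff_exists.1
    (hL.minorOrd_ne_top hcard ((keptRows r p q).orderEmbOfFin rfl))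
  rw [← hx]
  rfl

/-- The contribution of `L` to the entry `(i, j)` of the right filling of `(D_μ, L D_ρ)`. -/
noncomputable def leftPart (A : FMat K r) (i j : ℕ) : ℝ :=
  omitLeftOrd A (j + 1 - (i + 1)) j - omitLeftOrd A (j + 1 - (i + 1) + 1) (j + 1) -
    (omitLeftOrd A (j + 1 - i) j - omitLeftOrd A (j + 1 - i + 1) (j + 1))

theorem IsRightFilling.eq_leftPart_add {μ ρ : Fin r → ℝ} (hμ : Antitone μ) {L : FMat K r}
    (hL : IsRowGeneric μ L) {f : Fin r → Fin r → ℝ}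
    (hf : IsRightFilling (diagT K μ) (L * diagT K ρ) f) {i j : Fin r} (hij : i ≤ j)
    (hρ : ∀ k, r ≤ k + (i + 1) → LeftMinimal L ρ k) :
    f i j = leftPart L i j + if i = j then ρ i.rev else 0 := by
  obtain ⟨μ', N', hμ', hN, hpair, hform⟩ := hf
  -- The partition chosen by the filling is forced by the orbit.
  obtain rfl : μ' = μ := by
    obtain ⟨P, Q, T, hP, hQ, -, hD, -⟩ := hpair
    exact eq_of_diagT_eq_mul hμ hμ' hP hQ.inv hD
  have hij' := Fin.le_def.1 hij
  have hj := j.2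
  have key : ∀ {p q c : ℕ}, (keptRows r p q).card = c → r ≤ c + (i + 1) →
      omitOrd N' p q = omitLeftOrd L p q + leadSum ρ c :=
    fun hc h => hL.omitOrd_eq hμ hN hpair hc (hρ _ h)
  have h2 := key (p := j + 1 - (i + 1) + 1) (q := j + 1)
    (card_keptRows (n := i + 1) (by omega) (by omega) (by omega)) (by omega)
  have h3 := key (p := j + 1 - i) (q := j)
    (card_keptRows (n := i) (by omega) (by omega) (by omega)) (by omega)
  have h4 := key (p := j + 1 - i + 1) (q := j + 1)
    (card_keptRows (n := i) (by omega) (by omega) (by omega)) (by omega)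
  rw [hform i j hij, partialSum, partialSum, leftPart, Nat.add_sub_cancel, h2, h3, h4]
  -- On the diagonal the first minor omits rows from `p = 0`, hence only `i` rows, and has size `r -
  -- i` rather than `r - (i + 1)`. The sums of `ρ` then leave the entry at `i.rev`; off the diagonal
  -- they cancel.
  split_ifs with h
  · subst h
    rw [key (p := i + 1 - (i + 1)) (q := i) (c := r - i)
      (by rw [Nat.sub_self, card_keptRows_zero (by omega)]) (by omega)]
    have h5 := leadSum_succ ρ i.rev.2
    have h6 : (i.rev : ℕ) = r - (i + 1) := Fin.val_rev i
    have h7 : r - (i + 1) + 1 = r - i := by omega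
    simp only [h6, h7] at h5
    have h8 : (⟨r - (i + 1), by omega⟩ : Fin r) = i.rev := rfl
    rw [h8] at h5
    rw [h5]
    ring
  · have hlt : (i : ℕ) < j := lt_of_le_of_ne hij' fun h' => h (Fin.ext h')
    rw [key (p := j + 1 - (i + 1)) (q := j)
      (card_keptRows (n := i + 1) (by omega) (by omega) (by omega)) (by omega)]
    ring

theorem leftMinimal_of_colGapIneq {ν ρ : Fin r → ℝ} {L : FMat K r} (hL : ColGapIneq ν L)
    (hρ : ∀ (h : k ≤ r) (J : IdxSet k r), idxSum (hat ν) J - idxSum (hat ν) (leftCols h) ≤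
      idxSum ρ J - idxSum ρ (leftCols h)) : LeftMinimal L ρ k := fun h I J => by
  refine (add_le_add_left (hL k I (leftCols h) J (leftCols_le h J)) _).trans ?_
  rw [add_assoc, ← WithTop.coe_add]
  gcongr
  exact WithTop.coe_le_coe.2 (le_sub_iff_add_le.1 (hρ h J))

theorem rightFilling_eq_rightFilling_truncPart {μ ν : Fin r → ℝ} (hμ : Antitone μ)
    {L : FMat K r} (hL : IsRowGeneric μ L) (hgap : ColGapIneq ν L) {σ : ℕ}
    (hσ : σ < r) {α : ℝ} (hν0 : ∀ i, 0 ≤ ν i) (hα : α ≤ ν ⟨σ, hσ⟩) {f g : Fin r → Fin r → ℝ}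
    (hf : IsRightFilling (diagT K μ) (L * diagT K (hat ν)) f)
    (hg : IsRightFilling (diagT K μ) (L * diagT K (hat (truncPart ν σ α))) g) {i j : Fin r}
    (hi : (i : ℕ) < σ) (hij : i ≤ j) : f i j = g i j := by
  rw [hf.eq_leftPart_add hμ hL hij fun k _ => leftMinimal_of_colGapIneq hgap fun _ _ => le_rfl,
    hg.eq_leftPart_add hμ hL hij fun k hk => leftMinimal_of_colGapIneq hgap fun h J => ?_]
  · simp [hat, truncPart, hi]
  -- The loss `d` from truncation is nonnegative and vanishes from position `k` on, because `k ≥ r -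
  -- (i + 1) ≥ r - σ`. So no column set loses more than the left-most one.
  · have h1 := idxSum_le_idxSum_leftCols (d := fun a => hat ν a - hat (truncPart ν σ α) a)
      (fun a => ?_) h (fun a ha => ?_) J
    · rw [idxSum_sub, idxSum_sub] at h1
      linarith
    · simp only [hat, truncPart]
      split_ifs with h2 h3
      · simp
      · have h4 : a.rev = ⟨σ, hσ⟩ := Fin.ext h3
        rw [h4]
        linarith
      · linarith [hν0 a.rev]
    · have h2 : (a.rev : ℕ) < σ := by
        rw [Fin.val_rev]
        omega
      simp only [hat, truncPart, if_pos h2, sub_self]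

end Fillings

/-! ### Exchanging the two matrices of a pair -/

section Transpose

variable {k r : ℕ}

theorem PairEquiv.trans {X Y M N A B : FMat K r} (h : PairEquiv X Y M N)
    (h' : PairEquiv M N A B) : PairEquiv X Y A B := by
  obtain ⟨P, Q, T, hP, hQ, hT, rfl, rfl⟩ := h
  obtain ⟨P', Q', T', hP', hQ', hT', rfl, rfl⟩ := h'
  refine ⟨P' * P, Q' * Q, T' * T, hP'.mul hP, hQ'.mul hQ, hT'.mul hT, ?_, ?_⟩ <;>
    simp only [Matrix.mul_inv_rev, Matrix.mul_assoc]

theorem IsRightFilling.of_pairEquiv {X Y M N : FMat K r} {f : Fin r → Fin r → ℝ}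
    (hf : IsRightFilling M N f) (h : PairEquiv X Y M N) : IsRightFilling X Y f := by
  obtain ⟨μ, N', hμ, hN, hpair, hform⟩ := hf
  exact ⟨μ, N', hμ, hN, h.trans hpair, hform⟩

/-- The reflection of a matrix in its antidiagonal. -/
def antiTranspose (L : FMat K r) : FMat K r := L.transpose.submatrix Fin.rev Fin.rev

theorem antiTranspose_eq (L : FMat K r) :
    antiTranspose L = revMat _ r * L.transpose * revMat _ r := by
  rw [revMat_mul, mul_revMat]
  rfl

theorem minorOrd_antiTranspose (L : FMat K r) (I J : IdxSet k r) :
    minorOrd (antiTranspose L) I J = minorOrd L (revIdx J) (revIdx I) := by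
  rw [← minorOrd_transpose, minorOrd, minorOrd,
    ← Matrix.det_submatrix_equiv_self (Fin.revPerm (n := k))]
  congr 1

theorem diagT_hat (μ : Fin r → ℝ) :
    diagT K (hat μ) = revMat _ r * diagT K μ * revMat _ r := by
  rw [revMat_mul, mul_revMat]
  ext i j
  simp [diagT, hat, Matrix.diagonal_apply]

/-- With $w$ the reversal, $D_{\widehat\nu}L^T=w\,D_\nu\,(wL^T)$, and the middle factor $wL^T$ can
be moved into the second matrix, where conjugation by $w$ gives the antitranspose. The transposed
pair thus has the shape treated for right fillings. -/
theorem pairEquiv_antiTranspose {L : FMat K r} (hL : InGLR L) (μ ν : Fin r → ℝ) :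
    PairEquiv (diagT K ν) (antiTranspose L * diagT K (hat μ))
      (L * diagT K (hat ν)).transpose (diagT K μ).transpose := by
  have hw := revMat_mul_self (r := r) (sparseSeries K)
  have hwI : (revMat (sparseSeries K) r)⁻¹ = revMat _ r := Matrix.inv_eq_right_inv hw
  have hwL := InGLR.revMat.mul hL.transpose
  refine ⟨revMat _ r, (revMat _ r * L.transpose)⁻¹, revMat _ r, InGLR.revMat, hwL.inv,
    InGLR.revMat, ?_, ?_⟩
  · rw [Matrix.transpose_mul, diagT_transpose, diagT_hat, Matrix.inv_eq_right_inv hwL.inv_mul,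
      Matrix.mul_assoc, Matrix.mul_assoc]
  · rw [diagT_transpose, hwI, antiTranspose_eq, diagT_hat, ← Matrix.mul_assoc,
      ← Matrix.mul_assoc, ← Matrix.mul_assoc, ← Matrix.mul_assoc, hwL.inv_mul, Matrix.one_mul, hw,
      Matrix.one_mul, Matrix.mul_assoc, hw, Matrix.mul_one]

theorem IsMuNuGeneric.isRowGeneric {μ ν : Fin r → ℝ} {L : FMat K r} (h : IsMuNuGeneric μ ν L) :
    IsRowGeneric μ L :=
  ⟨h.1, h.2.1, h.2.2.2.1, h.2.2.2.2.1⟩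

theorem IsMuNuGeneric.isRowGeneric_antiTranspose {μ ν : Fin r → ℝ} {L : FMat K r}
    (h : IsMuNuGeneric μ ν L) : IsRowGeneric ν (antiTranspose L) := by
  obtain ⟨hL, hlow, -, -, -, hcol, hcolgap⟩ := h
  refine ⟨?_, ?_, ?_, ?_⟩
  · rw [antiTranspose_eq]
    exact (InGLR.revMat.mul hL.transpose).mul InGLR.revMat
  · exact fun i j hij => hlow _ _ (Fin.rev_lt_rev.2 hij)
  · intro k I H J hJI hIH
    rw [minorOrd_antiTranspose, minorOrd_antiTranspose]
    exact hcol k _ _ _ hIH.revIdx hJI.revIdx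
  · intro k I H J hIH
    have h1 := hcolgap k (revIdx J) (revIdx H) (revIdx I) hIH.revIdx
    rwa [idxSum_hat, idxSum_hat, revIdx_revIdx, revIdx_revIdx, ← minorOrd_antiTranspose,
      ← minorOrd_antiTranspose] at h1

theorem IsMuNuGeneric.colGapIneq_antiTranspose {μ ν : Fin r → ℝ} {L : FMat K r}
    (h : IsMuNuGeneric μ ν L) : ColGapIneq μ (antiTranspose L) := by
  intro k I H J hHJ
  have h1 := h.2.2.2.2.1 k (revIdx J) (revIdx H) (revIdx I) hHJ.revIdx
  rwa [← idxSum_hat, ← idxSum_hat, ← minorOrd_antiTranspose, ← minorOrd_antiTranspose] at h1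

end Transpose

end

theorem mainTheorem6 {K : Type*} [Field K] [CharZero K] {r : ℕ}
    (μ ν : Fin r → ℝ) (hμ : Antitone μ) (hν : Antitone ν)
    (L : FMat K r) (hL : IsMuNuGeneric μ ν L) :
    (∀ (σ : ℕ) (hσ : σ < r) (α : ℝ), (∀ i, 0 ≤ ν i) → 0 < α → α ≤ ν ⟨σ, hσ⟩ →
      ∀ k k' : Fin r → Fin r → ℝ,
        IsRightFilling (diagT K μ) (L * diagT K (hat ν)) k →
        IsRightFilling (diagT K μ) (L * diagT K (hat (truncPart ν σ α))) k' →
        ∀ i j : Fin r, (i : ℕ) < σ → i ≤ j → k i j = k' i j) ∧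
    (∀ (σ : ℕ) (hσ : σ < r) (α : ℝ), (∀ i, 0 ≤ μ i) → 0 < α → α ≤ μ ⟨σ, hσ⟩ →
      ∀ m m' : Fin r → Fin r → ℝ,
        IsLeftFilling (diagT K μ) (L * diagT K (hat ν)) m →
        IsLeftFilling (diagT K (truncPart μ σ α)) (L * diagT K (hat ν)) m' →
        ∀ i j : Fin r, (i : ℕ) < σ → i ≤ j → m i j = m' i j) := by
  refine ⟨fun σ hσ α h0 _ hα k k' hk hk' i j hi hij => ?_,
    fun σ hσ α h0 _ hα m m' hm hm' i j hi hij => ?_⟩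
  · exact rightFilling_eq_rightFilling_truncPart hμ hL.isRowGeneric hL.2.2.2.2.2.2 hσ h0 hα
      hk hk' hi hij
  · exact rightFilling_eq_rightFilling_truncPart hν hL.isRowGeneric_antiTranspose
      hL.colGapIneq_antiTranspose hσ h0 hα (hm.of_pairEquiv (pairEquiv_antiTranspose hL.1 _ _))
      (hm'.of_pairEquiv (pairEquiv_antiTranspose hL.1 _ _)) hi hij
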